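/- Let $\mathcal W$ and $\mathcal Z$ be measurable spaces, $\mu$ a probability distribution on $\mathcal Z$, $n\ge 1$, and let $S_n=(Z_1,\dots,Z_n)$ consist of $n$ i.i.d. points with distribution $\mu$. A (randomized) learning algorithm is a Markov kernel $\kappa$ from $\mathcal Z^n$ to $\mathcal W$; its output $W_n$ has conditional law $\kappa(\cdot,s)$ given $S_n=s$. Let $P_n$ be the joint law of $(W_n,S_n)$ and $P_0=P_{W_n}\otimes\mu^n$ the product of its marginals. Let $\ell:\mathcal W\times\mathcal Z\to[0,\infty)$ be a measurable loss with $\mathbb E[\ell(w,Z)]<\infty$ for every $w\in\mathcal W$, where $Z\sim\mu$. Put $\overline\ell(w,z)=\ell(w,z)-\mathbb E[\ell(w,Z)]$, $\|\overline\ell(\cdot,z)\|_\infty=\sup_{w\in\mathcal W}|\overline\ell(w,z)|$ and $$\mathrm{gen}(w,s)=\frac1n\sum_{i=1}^n\ell(w,z_i)-\mathbb E[\ell(w,Z)]\qquad(s=(z_1,\dots,z_n)).$$ If $\mathbb E[\|\overline\ell(\cdot,Z)\|_\infty^2]<\infty$, then $\mathrm{gen}(W_n,S_n)$ is integrable. Moreover,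 for every learning algorithm, $$\bigl|\mathbb E[\mathrm{gen}(W_n,S_n)]\bigr|\le\sqrt{\frac{4\,D_{\mathrm{KL}}(P_n\|P_0)\,\mathbb E\bigl[\|\overline\ell(\cdot,Z)\|_\infty^2\bigr]}{n}},$$ whenever $\mathbb E[\mathrm{gen}(W_n,S_n)]$ is well defined, i.e. $\mathrm{gen}(W_n,S_n)$ is integrable; the right-hand side takes values in $[0,\infty]$ (with $0\cdot\infty=0$), and $D_{\mathrm{KL}}(P_n\|P_0)\in[0,\infty]$ is the relative entropy, i.e. the mutual information between $W_n$ and $S_n$. No subgaussianity or boundedness of the loss is assumed. -/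

import Mathlib

open MeasureTheory ProbabilityTheory
open scoped ENNReal

namespace GenBound

noncomputable section

/-- The law `μ^n` of a data set `S_n = (Z_1, …, Z_n)` of `n` i.i.d. points with distribution `μ`. -/
def dataLaw {Z : Type*} [MeasurableSpace Z] (n : ℕ) (μ : Measure Z) : Measure (Fin n → Z) :=
  Measure.pi fun _ => μ

/-- The joint law `P_n` of `(W_n, S_n)`, where `S_n ∼ μ^n` and, given `S_n = s`, the (randomized)
output `W_n` of the learning algorithm has law `κ s`. -/
def jointLaw {W Z : Type*} [MeasurableSpace W] [MeasurableSpace Z] {n : ℕ}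
    (μ : Measure Z) (κ : Kernel (Fin n → Z) W) : Measure (W × (Fin n → Z)) :=
  (dataLaw n μ ⊗ₘ κ).map Prod.swap

/-- The product `P_0 = P_{W_n} ⊗ μ^n` of the marginal law of `W_n` and the law of `S_n`. -/
def productLaw {W Z : Type*} [MeasurableSpace W] [MeasurableSpace Z] {n : ℕ}
    (μ : Measure Z) (κ : Kernel (Fin n → Z) W) : Measure (W × (Fin n → Z)) :=
  ((jointLaw μ κ).map Prod.fst).prod (dataLaw n μ)

/-- The training error `L(w, s) = (1/n) ∑ i, ℓ(w, z_i)`. -/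
def trainError {W Z : Type*} {n : ℕ} (ℓ : W → Z → ℝ) (w : W) (s : Fin n → Z) : ℝ :=
  (∑ i, ℓ w (s i)) / n

/-- The test error `E[ℓ(w, Z')]`, `Z' ∼ μ`, of a hypothesis `w`. -/
def testError {W Z : Type*} [MeasurableSpace Z] (μ : Measure Z) (ℓ : W → Z → ℝ) (w : W) : ℝ :=
  ∫ z, ℓ w z ∂μ

/-- The generalization error `gen(w, s)`: training error minus test error. -/
def gen {W Z : Type*} [MeasurableSpace Z] {n : ℕ} (μ : Measure Z) (ℓ : W → Z → ℝ)
    (w : W) (s : Fin n → Z) : ℝ :=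
  trainError ℓ w s - testError μ ℓ w

/-- The centered loss `ℓ(w, z) - E[ℓ(w, Z)]`. -/
def centeredLoss {W Z : Type*} [MeasurableSpace Z] (μ : Measure Z) (ℓ : W → Z → ℝ)
    (w : W) (z : Z) : ℝ :=
  ℓ w z - ∫ z', ℓ w z' ∂μ

/-- The second moment `E_Z[(sup_w |centered loss (w, Z)|)²]`, with values in `[0, ∞]`. -/
def supNormSecondMoment {W Z : Type*} [MeasurableSpace Z] (μ : Measure Z) (ℓ : W → Z → ℝ) :
    ℝ≥0∞ :=
  ∫⁻ z, (⨆ w : W, ENNReal.ofReal |centeredLoss μ ℓ w z|) ^ 2 ∂μ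

end

end GenBound

/-! Self-normalization replaces exponential moments. Let X_i be the centered loss at z_i, and V =
E[sup_w |centered loss|²], assumed finite. Since exp(x - x²/2) ≤ 1 + x + x²/2, any centered X with
E[X²] ≤ V satisfies E exp(tX - t²X²/2 - t²V/2) ≤ 1. For fixed w the X_i are independent under μ^n,
so the exponential of the summed exponents has mean at most 1 under P_0. The variational inequality
for relative entropy then bounds the P_n-mean of the sum by K = KL(P_n‖P_0). Under P_n the output
depends on the data, but the supremum over w still gives E[X_i²] ≤ V. Hence t n E[gen] - t² n V ≤ K
for all real t, and a discriminant yields E[gen]² ≤ 4KV/n. -/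

theorem Real.exp_sub_sq_div_two_le (x : ℝ) : Real.exp (x - x ^ 2 / 2) ≤ 1 + x + x ^ 2 / 2 := by
  have hpos : 0 < 1 + x + x ^ 2 / 2 := by nlinarith [sq_nonneg (x + 1)]
  rw [← Real.le_log_iff_exp_le hpos]
  rcases le_total 0 x with hx | hx
  · have hy : 0 ≤ x + x ^ 2 / 2 := by positivity
    -- With y = x + x²/2, log(1 + y) ≥ 2y/(y + 2), and (x - x²/2)(y + 2) = 2x - x⁴/4 ≤ 2y.
    have h := Real.le_log_one_add_of_nonneg hy
    rw [← add_assoc] at h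
    refine le_trans ?_ h
    rw [le_div_iff₀ (by positivity)]
    nlinarith [pow_nonneg hx 4]
  -- For x ≤ 0 even exp x ≤ 1 + x + x²/2, because (1 + x + x²/2)(1 - x + x²/2) = 1 + x⁴/4 ≥ 1.
  · have h : Real.exp x * (1 - x + x ^ 2 / 2) ≤ 1 := by
      have h1 := Real.quadratic_le_exp_of_nonneg (neg_nonneg.mpr hx)
      calc Real.exp x * (1 - x + x ^ 2 / 2) ≤ Real.exp x * Real.exp (-x) := by
            gcongr
            linarith [neg_sq x]
        _ = 1 := by rw [← Real.exp_add]; simp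
    have h2 : 0 < 1 - x + x ^ 2 / 2 := by nlinarith [sq_nonneg x]
    have h3 : Real.exp x ≤ 1 + x + x ^ 2 / 2 := by
      refine le_of_mul_le_mul_right (h.trans ?_) h2
      nlinarith [pow_nonneg (sq_nonneg x) 2]
    exact (sub_le_self x (by positivity)).trans ((Real.le_log_iff_exp_le hpos).mpr h3)

/-- Fenchel–Young: y ↦ exp y - 1 is the convex conjugate of `klFun`. -/
theorem InformationTheory.mul_le_klFun_add_exp_sub_one {r : ℝ} (hr : 0 ≤ r) (y : ℝ) :
    r * y ≤ klFun r + Real.exp y - 1 := by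
  rw [klFun_apply]
  rcases hr.eq_or_lt with rfl | hr
  · simpa using (Real.exp_pos y).le
  · have h := Real.add_one_le_exp (y - Real.log r)
    rw [Real.exp_sub, Real.exp_log hr, le_div_iff₀ hr] at h
    linarith

/-- Half of the Donsker–Varadhan formula, from integrating Fenchel–Young with r = dP/dQ. -/
theorem InformationTheory.integral_le_toReal_klDiv {α : Type*} [MeasurableSpace α]
    {P Q : Measure α} [IsProbabilityMeasure P] [IsProbabilityMeasure Q] (hPQ : klDiv P Q ≠ ∞)
    {f : α → ℝ} (hf : Integrable f P) (hexp : Integrable (fun x => Real.exp (f x)) Q)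
    (hle : ∫ x, Real.exp (f x) ∂Q ≤ 1) : ∫ x, f x ∂P ≤ (klDiv P Q).toReal := by
  obtain ⟨hac, hllr⟩ := klDiv_ne_top_iff.mp hPQ
  have hkl : Integrable (fun x => klFun (P.rnDeriv Q x).toReal) Q :=
    (integrable_klFun_rnDeriv_iff hac).mpr hllr
  have hrf : Integrable (fun x => (P.rnDeriv Q x).toReal * f x) Q :=
    (integrable_rnDeriv_smul_iff hac).mpr hf
  calc ∫ x, f x ∂P = ∫ x, (P.rnDeriv Q x).toReal * f x ∂Q := (integral_rnDeriv_smul hac).symm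
    _ ≤ ∫ x, (klFun (P.rnDeriv Q x).toReal + Real.exp (f x) - 1) ∂Q :=
        integral_mono hrf ((hkl.add hexp).sub (integrable_const 1))
          fun x => mul_le_klFun_add_exp_sub_one ENNReal.toReal_nonneg _
    _ = (klDiv P Q).toReal + ∫ x, Real.exp (f x) ∂Q - 1 := by
        rw [integral_sub (hkl.fun_add hexp) (integrable_const 1), integral_add hkl hexp,
          toReal_klDiv_eq_integral_klFun hac]
        simp
    _ ≤ (klDiv P Q).toReal := by linarith

namespace GenBound

/-! ### Self-normalized exponential moments -/

section ExpMoment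

variable {Z : Type*} [MeasurableSpace Z] {μ : Measure Z} [IsProbabilityMeasure μ]

/-- The self-normalized exponent `t x - t² x² / 2 - t² V / 2`. -/
noncomputable def exponent (t V x : ℝ) : ℝ := t * x - (t * x) ^ 2 / 2 - t ^ 2 * V / 2

/-- As u - u²/2 ≤ 1/2, the exponential is bounded, hence integrable with no tail assumption on the
loss. -/
theorem exponent_le {V : ℝ} (hV : 0 ≤ V) (t x : ℝ) : exponent t V x ≤ 1 / 2 := by
  have : 0 ≤ t ^ 2 * V := by positivity
  unfold exponent
  nlinarith [sq_nonneg (t * x - 1)]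

theorem measurable_exponent (t V : ℝ) : Measurable (exponent t V) := by
  unfold exponent; fun_prop

theorem integrable_exp_of_le {α : Type*} [MeasurableSpace α] {ν : Measure α} [IsFiniteMeasure ν]
    {f : α → ℝ} (hf : Measurable f) {C : ℝ} (hC : ∀ x, f x ≤ C) :
    Integrable (fun x => Real.exp (f x)) ν := by
  refine Integrable.of_bound hf.exp.aestronglyMeasurable (Real.exp C) (ae_of_all _ fun x => ?_)
  rw [Real.norm_eq_abs, Real.abs_exp]
  exact Real.exp_le_exp.mpr (hC x)

theorem integral_exp_exponent_le_one {X : Z → ℝ} (hX : Measurable X) (hX1 : Integrable X μ)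
    (hX2 : Integrable (fun z => X z ^ 2) μ) (h0 : ∫ z, X z ∂μ = 0) {V : ℝ}
    (hV : ∫ z, X z ^ 2 ∂μ ≤ V) (t : ℝ) :
    ∫ z, Real.exp (exponent t V (X z)) ∂μ ≤ 1 := by
  have hV0 : 0 ≤ V := (integral_nonneg fun z => sq_nonneg (X z)).trans hV
  have hb : Integrable (fun z => Real.exp (-(t ^ 2 * V / 2)) *
      (1 + t * X z + t ^ 2 / 2 * X z ^ 2)) μ :=
    (((integrable_const 1).add (hX1.const_mul t)).add (hX2.const_mul (t ^ 2 / 2))).const_mul _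
  calc ∫ z, Real.exp (exponent t V (X z)) ∂μ
      ≤ ∫ z, Real.exp (-(t ^ 2 * V / 2)) * (1 + t * X z + t ^ 2 / 2 * X z ^ 2) ∂μ := by
        refine integral_mono (integrable_exp_of_le ((measurable_exponent t V).comp hX)
          fun z => exponent_le hV0 t _) hb fun z => ?_
        dsimp only
        rw [exponent, sub_eq_neg_add _ (t ^ 2 * V / 2), Real.exp_add]
        gcongr
        calc _ ≤ _ := Real.exp_sub_sq_div_two_le (t * X z)
          _ = _ := by ring
    _ = Real.exp (-(t ^ 2 * V / 2)) * (1 + t ^ 2 / 2 * ∫ z, X z ^ 2 ∂μ) := by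
        rw [integral_const_mul, integral_add ((integrable_const 1).fun_add (hX1.const_mul t))
          (hX2.const_mul (t ^ 2 / 2)), integral_add (integrable_const 1) (hX1.const_mul t),
          integral_const_mul, integral_const_mul, h0]
        simp
    _ ≤ Real.exp (-(t ^ 2 * V / 2)) * Real.exp (t ^ 2 * V / 2) := by
        gcongr
        have h1 : t ^ 2 / 2 * ∫ z, X z ^ 2 ∂μ ≤ t ^ 2 / 2 * V := by gcongr
        linarith [Real.add_one_le_exp (t ^ 2 * V / 2)]
    _ = 1 := by rw [← Real.exp_add]; simp

end ExpMoment

section DataLaw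

variable {Z : Type*} [MeasurableSpace Z] {n : ℕ} (μ : Measure Z) [IsProbabilityMeasure μ]

instance : IsProbabilityMeasure (dataLaw n μ) := by
  unfold dataLaw; infer_instance

/-- The function `H` need not be measurable: its integral is a lower integral. -/
theorem lintegral_dataLaw_le_of_le_eval {F : (Fin n → Z) → ℝ≥0∞} (hF : Measurable F)
    (H : Z → ℝ≥0∞) (i : Fin n) (hFH : ∀ s, F s ≤ H (s i)) :
    ∫⁻ s, F s ∂(dataLaw n μ) ≤ ∫⁻ z, H z ∂μ := by
  obtain _ | m := n
  · exact i.elim0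
  have mp := (measurePreserving_piFinSuccAbove (fun _ : Fin (m + 1) => μ) i).symm
  rw [dataLaw, ← mp.lintegral_comp hF, lintegral_prod (fun x => F ((MeasurableEquiv.piFinSuccAbove (fun _ => Z) i).symm x))
     (hF.comp mp.measurable).aemeasurable]
  refine lintegral_mono fun z => ?_
  calc _ ≤ ∫⁻ _, H z ∂(Measure.pi fun _ : Fin m => μ) :=
        lintegral_mono fun s => (hFH _).trans_eq
          (congrArg H (Fin.insertNth_apply_same (α := fun _ => Z) i z s))
    _ = H z := by simp

end DataLaw

section CenteredLoss

variable {W Z : Type*} [MeasurableSpace Z] {μ : Measure Z} {ℓ : W → Z → ℝ}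

theorem ofReal_centeredLoss_sq_le (w : W) (z : Z) :
    ENNReal.ofReal (centeredLoss μ ℓ w z ^ 2) ≤
      (⨆ w : W, ENNReal.ofReal |centeredLoss μ ℓ w z|) ^ 2 := by
  rw [← sq_abs, ENNReal.ofReal_pow (abs_nonneg _)]
  gcongr
  exact le_iSup (fun w => ENNReal.ofReal |centeredLoss μ ℓ w z|) w

theorem lintegral_centeredLoss_sq_le (w : W) :
    ∫⁻ z, ENNReal.ofReal (centeredLoss μ ℓ w z ^ 2) ∂μ ≤ supNormSecondMoment μ ℓ :=
  lintegral_mono fun z => ofReal_centeredLoss_sq_le w z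

theorem gen_eq_sum_centeredLoss {n : ℕ} (hn : n ≠ 0) (w : W) (s : Fin n → Z) :
    gen μ ℓ w s = (∑ i, centeredLoss μ ℓ w (s i)) / n := by
  have : (n : ℝ) ≠ 0 := Nat.cast_ne_zero.mpr hn
  simp only [gen, trainError, testError, centeredLoss, Finset.sum_sub_distrib, Finset.sum_const,
    Finset.card_univ, Fintype.card_fin, nsmul_eq_mul]
  field_simp

theorem integral_centeredLoss_eq_zero [IsProbabilityMeasure μ] {w : W} (hℓ : Integrable (ℓ w) μ) :
    ∫ z, centeredLoss μ ℓ w z ∂μ = 0 := by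
  simp only [centeredLoss]
  rw [integral_sub hℓ (integrable_const _)]
  simp

end CenteredLoss

/-! ### Joint law against product law -/

section Laws

variable {W Z : Type*} [MeasurableSpace W] [MeasurableSpace Z] {n : ℕ}
  {μ : Measure Z} [IsProbabilityMeasure μ] {κ : Kernel (Fin n → Z) W} [IsMarkovKernel κ]
  {ℓ : W → Z → ℝ}

instance : IsProbabilityMeasure (jointLaw μ κ) := by
  unfold jointLaw
  exact Measure.isProbabilityMeasure_map measurable_swap.aemeasurable

instance : IsProbabilityMeasure ((jointLaw μ κ).map Prod.fst) :=
  Measure.isProbabilityMeasure_map measurable_fst.aemeasurable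

instance : IsProbabilityMeasure (productLaw μ κ) := by
  unfold productLaw; infer_instance

theorem measurable_uncurry_centeredLoss (hℓ : Measurable (Function.uncurry ℓ)) :
    Measurable (Function.uncurry (centeredLoss μ ℓ)) := by
  have h : Measurable fun w => ∫ z, ℓ w z ∂μ :=
    (hℓ.stronglyMeasurable.integral_prod_right (ν := μ)).measurable
  exact hℓ.sub (h.comp measurable_fst)

theorem measurable_centeredLoss_eval (hℓ : Measurable (Function.uncurry ℓ)) (i : Fin n) :
    Measurable fun p : W × (Fin n → Z) => centeredLoss μ ℓ p.1 (p.2 i) :=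
  (measurable_uncurry_centeredLoss hℓ).comp
    (measurable_fst.prodMk ((measurable_pi_apply i).comp measurable_snd))

/-- Taking the supremum over w removes the dependence of the output on the data, leaving a function
of z_i ∼ μ alone. -/
theorem lintegral_jointLaw_centeredLoss_sq_le (hℓ : Measurable (Function.uncurry ℓ))
    (i : Fin n) :
    ∫⁻ p, ENNReal.ofReal (centeredLoss μ ℓ p.1 (p.2 i) ^ 2) ∂(jointLaw μ κ) ≤
      supNormSecondMoment μ ℓ := by
  have hm : Measurable fun p : W × (Fin n → Z) =>
      ENNReal.ofReal (centeredLoss μ ℓ p.1 (p.2 i) ^ 2) :=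
    ((measurable_centeredLoss_eval hℓ i).pow_const 2).ennreal_ofReal
  rw [jointLaw, lintegral_map hm measurable_swap,
    Measure.lintegral_compProd (by exact hm.comp measurable_swap)]
  refine lintegral_dataLaw_le_of_le_eval μ (hm.comp measurable_swap).lintegral_kernel_prod_right' _ i
    fun s => ?_
  calc _ ≤ ∫⁻ _, (⨆ w : W, ENNReal.ofReal |centeredLoss μ ℓ w (s i)|) ^ 2 ∂(κ s) :=
        lintegral_mono fun w => ofReal_centeredLoss_sq_le w (s i)
    _ = _ := by simp

theorem integrable_sq_of_lintegral_ne_top {α : Type*} [MeasurableSpace α] {ν : Measure α}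
    {f : α → ℝ} (hf : Measurable f) (h : ∫⁻ x, ENNReal.ofReal (f x ^ 2) ∂ν ≠ ∞) :
    Integrable (fun x => f x ^ 2) ν :=
  (lintegral_ofReal_ne_top_iff_integrable (hf.pow_const 2).aestronglyMeasurable
    (ae_of_all _ fun x => sq_nonneg (f x))).mp h

theorem integral_sq_le_toReal {α : Type*} [MeasurableSpace α] {ν : Measure α}
    {f : α → ℝ} (hf : Measurable f) {M : ℝ≥0∞} (hM : M ≠ ∞)
    (h : ∫⁻ x, ENNReal.ofReal (f x ^ 2) ∂ν ≤ M) : ∫ x, f x ^ 2 ∂ν ≤ M.toReal := by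
  rw [integral_eq_lintegral_of_nonneg_ae (ae_of_all _ fun x => sq_nonneg (f x))
    (hf.pow_const 2).aestronglyMeasurable]
  exact ENNReal.toReal_mono hM h

theorem integrable_of_integrable_sq {α : Type*} [MeasurableSpace α] {ν : Measure α}
    [IsFiniteMeasure ν] {f : α → ℝ} (hf : Measurable f) (h : Integrable (fun x => f x ^ 2) ν) :
    Integrable f ν :=
  ((memLp_two_iff_integrable_sq hf.aestronglyMeasurable).mpr h).integrable one_le_two

theorem integral_exp_sum_exponent_le_one (hℓ : Measurable (Function.uncurry ℓ))
    (hint : ∀ w, Integrable (ℓ w) μ) (hM : supNormSecondMoment μ ℓ ≠ ∞) (t : ℝ) :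
    Integrable (fun p : W × (Fin n → Z) => Real.exp (∑ i,
        exponent t (supNormSecondMoment μ ℓ).toReal (centeredLoss μ ℓ p.1 (p.2 i))))
      (productLaw μ κ) ∧
    ∫ p, Real.exp (∑ i,
        exponent t (supNormSecondMoment μ ℓ).toReal (centeredLoss μ ℓ p.1 (p.2 i)))
      ∂(productLaw μ κ) ≤ 1 := by
  set V := (supNormSecondMoment μ ℓ).toReal
  have hexp : Integrable (fun p : W × (Fin n → Z) => Real.exp (∑ i,
      exponent t V (centeredLoss μ ℓ p.1 (p.2 i)))) (productLaw μ κ) := by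
    refine integrable_exp_of_le (C := ∑ _i : Fin n, (1 / 2 : ℝ)) ?_ fun p =>
      Finset.sum_le_sum fun i _ => exponent_le ENNReal.toReal_nonneg t _
    exact Finset.measurable_sum _ fun i _ =>
      (measurable_exponent t V).comp (measurable_centeredLoss_eval hℓ i)
  refine ⟨hexp, ?_⟩
  rw [productLaw] at hexp ⊢
  rw [integral_prod _ hexp]
  have hw : ∀ w, ∫ s : Fin n → Z, Real.exp (∑ i, exponent t V (centeredLoss μ ℓ w (s i)))
      ∂(dataLaw n μ) ≤ 1 := by
    intro w
    have hX : Measurable (centeredLoss μ ℓ w) :=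
      (measurable_uncurry_centeredLoss hℓ).comp measurable_prodMk_left
    have hX2 := lintegral_centeredLoss_sq_le (μ := μ) (ℓ := ℓ) w
    simp_rw [Real.exp_sum]
    rw [dataLaw, integral_fintype_prod_eq_prod
      (fun (_ : Fin n) z => Real.exp (exponent t V (centeredLoss μ ℓ w z)))]
    refine Finset.prod_le_one (fun i _ => integral_nonneg fun z => (Real.exp_pos _).le)
      fun i _ => ?_
    exact integral_exp_exponent_le_one hX ((hint w).sub (integrable_const _))
      (integrable_sq_of_lintegral_ne_top hX (ne_top_of_le_ne_top hM hX2))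
      (integral_centeredLoss_eq_zero (hint w)) (integral_sq_le_toReal hX hM hX2) t
  calc _ ≤ ∫ _, (1 : ℝ) ∂((jointLaw μ κ).map Prod.fst) :=
        integral_mono hexp.integral_prod_left (integrable_const 1) hw
    _ = 1 := by simp

theorem integrable_centeredLoss_sq_eval (hℓ : Measurable (Function.uncurry ℓ))
    (hM : supNormSecondMoment μ ℓ ≠ ∞) (i : Fin n) :
    Integrable (fun p : W × (Fin n → Z) => centeredLoss μ ℓ p.1 (p.2 i) ^ 2)
      (jointLaw μ κ) :=
  integrable_sq_of_lintegral_ne_top (measurable_centeredLoss_eval hℓ i)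
    (ne_top_of_le_ne_top hM (lintegral_jointLaw_centeredLoss_sq_le hℓ i))

theorem integrable_centeredLoss_eval (hℓ : Measurable (Function.uncurry ℓ))
    (hM : supNormSecondMoment μ ℓ ≠ ∞) (i : Fin n) :
    Integrable (fun p : W × (Fin n → Z) => centeredLoss μ ℓ p.1 (p.2 i)) (jointLaw μ κ) :=
  integrable_of_integrable_sq (measurable_centeredLoss_eval hℓ i)
    (integrable_centeredLoss_sq_eval hℓ hM i)

theorem integrable_gen (hn : n ≠ 0) (hℓ : Measurable (Function.uncurry ℓ))
    (hM : supNormSecondMoment μ ℓ ≠ ∞) :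
    Integrable (fun p : W × (Fin n → Z) => gen μ ℓ p.1 p.2) (jointLaw μ κ) := by
  simp_rw [gen_eq_sum_centeredLoss hn]
  exact (integrable_finsetSum _ fun i _ => integrable_centeredLoss_eval hℓ hM i).div_const _

theorem mul_integral_gen_le (hn : n ≠ 0) (hℓ : Measurable (Function.uncurry ℓ))
    (hint : ∀ w, Integrable (ℓ w) μ) (hM : supNormSecondMoment μ ℓ ≠ ∞)
    (hK : InformationTheory.klDiv (jointLaw μ κ) (productLaw μ κ) ≠ ∞) (t : ℝ) :
    t * (n * ∫ p, gen μ ℓ p.1 p.2 ∂(jointLaw μ κ)) ≤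
      (InformationTheory.klDiv (jointLaw μ κ) (productLaw μ κ)).toReal +
        t ^ 2 * (n * (supNormSecondMoment μ ℓ).toReal) := by
  have hn' : (n : ℝ) ≠ 0 := Nat.cast_ne_zero.mpr hn
  set V := (supNormSecondMoment μ ℓ).toReal
  have h1 := integrable_centeredLoss_eval (κ := κ) hℓ hM
  have h2 := integrable_centeredLoss_sq_eval (κ := κ) hℓ hM
  have he : ∀ i, Integrable (fun p : W × (Fin n → Z) =>
      exponent t V (centeredLoss μ ℓ p.1 (p.2 i))) (jointLaw μ κ) := fun i => by
    simp only [exponent, mul_pow]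
    exact (((h1 i).const_mul t).sub (((h2 i).const_mul (t ^ 2)).div_const 2)).sub
      (integrable_const _)
  -- The loss t²V is half the empirical square, bounded in mean by V, and half the deterministic
  -- term of `exponent`.
  have hle : ∀ i, t * ∫ p, centeredLoss μ ℓ p.1 (p.2 i) ∂(jointLaw μ κ) - t ^ 2 * V ≤
      ∫ p, exponent t V (centeredLoss μ ℓ p.1 (p.2 i)) ∂(jointLaw μ κ) := fun i => by
    have hV : ∫ p, centeredLoss μ ℓ p.1 (p.2 i) ^ 2 ∂(jointLaw μ κ) ≤ V :=
      integral_sq_le_toReal (measurable_centeredLoss_eval hℓ i) hM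
        (lintegral_jointLaw_centeredLoss_sq_le hℓ i)
    simp only [exponent, mul_pow]
    have hs : Integrable (fun p : W × (Fin n → Z) => t * centeredLoss μ ℓ p.1 (p.2 i) -
        t ^ 2 * centeredLoss μ ℓ p.1 (p.2 i) ^ 2 / 2) (jointLaw μ κ) :=
      ((h1 i).const_mul t).sub (((h2 i).const_mul (t ^ 2)).div_const 2)
    rw [integral_sub hs (integrable_const _), integral_sub ((h1 i).const_mul t)
      (((h2 i).const_mul (t ^ 2)).div_const 2), integral_div, integral_const_mul,
      integral_const_mul]
    simp only [integral_const, probReal_univ, one_smul]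
    nlinarith [mul_le_mul_of_nonneg_left hV (sq_nonneg t)]
  obtain ⟨hexp, hexp1⟩ := integral_exp_sum_exponent_le_one (κ := κ) hℓ hint hM t
  have hkl := InformationTheory.integral_le_toReal_klDiv hK
    (integrable_finsetSum _ fun i _ => he i) hexp hexp1
  rw [integral_finsetSum _ fun i _ => he i] at hkl
  have hsum := (Finset.sum_le_sum fun i (_ : i ∈ Finset.univ) => hle i).trans hkl
  have hgen : n * ∫ p, gen μ ℓ p.1 p.2 ∂(jointLaw μ κ) =
      ∑ i, ∫ p, centeredLoss μ ℓ p.1 (p.2 i) ∂(jointLaw μ κ) := by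
    simp_rw [gen_eq_sum_centeredLoss hn]
    rw [integral_div, integral_finsetSum _ fun i _ => h1 i, mul_div_cancel₀ _ hn']
  rw [Finset.sum_sub_distrib, ← Finset.mul_sum, ← hgen] at hsum
  simp only [Finset.sum_const, Finset.card_univ, Fintype.card_fin, nsmul_eq_mul] at hsum
  linarith

theorem sq_integral_gen_le (hn : n ≠ 0) (hℓ : Measurable (Function.uncurry ℓ))
    (hint : ∀ w, Integrable (ℓ w) μ) (hM : supNormSecondMoment μ ℓ ≠ ∞)
    (hK : InformationTheory.klDiv (jointLaw μ κ) (productLaw μ κ) ≠ ∞) :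
    (∫ p, gen μ ℓ p.1 p.2 ∂(jointLaw μ κ)) ^ 2 ≤
      4 * (InformationTheory.klDiv (jointLaw μ κ) (productLaw μ κ)).toReal *
        (supNormSecondMoment μ ℓ).toReal / n := by
  have hn' : (0 : ℝ) < n := Nat.cast_pos.mpr (Nat.pos_of_ne_zero hn)
  set g := ∫ p, gen μ ℓ p.1 p.2 ∂(jointLaw μ κ) with hg
  set K := (InformationTheory.klDiv (jointLaw μ κ) (productLaw μ κ)).toReal
  set V := (supNormSecondMoment μ ℓ).toReal
  -- The quadratic nV t² - ng t + K is nonnegative for every t of either sign, so n²g² ≤ 4nVK.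
  have hd : discrim (n * V) (-(n * g)) K ≤ 0 := discrim_le_zero fun t => by
    have := mul_integral_gen_le (κ := κ) hn hℓ hint hM hK t
    rw [← hg] at this
    linarith
  rw [discrim] at hd
  rw [le_div_iff₀ hn']
  refine le_of_mul_le_mul_left ?_ hn'
  linarith

theorem integral_gen_eq_zero_of_supNormSecondMoment_eq_zero (hn : n ≠ 0)
    (hℓ : Measurable (Function.uncurry ℓ)) (hM : supNormSecondMoment μ ℓ = 0) :
    ∫ p, gen μ ℓ p.1 p.2 ∂(jointLaw μ κ) = 0 := by
  refine integral_eq_zero_of_ae ?_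
  have h : ∀ i : Fin n, ∀ᵐ p ∂(jointLaw μ κ), centeredLoss μ ℓ p.1 (p.2 i) = 0 := fun i => by
    have h0 := le_antisymm
      ((lintegral_jointLaw_centeredLoss_sq_le (κ := κ) hℓ i).trans_eq hM) zero_le
    rw [lintegral_eq_zero_iff
      ((measurable_centeredLoss_eval hℓ i).pow_const 2).ennreal_ofReal] at h0
    filter_upwards [h0] with p hp
    simpa [ENNReal.ofReal_eq_zero] using hp
  filter_upwards [ae_all_iff.mpr h] with p hp
  rw [gen_eq_sum_centeredLoss hn]
  simp [hp]

theorem integral_gen_eq_zero_of_jointLaw_eq_productLaw (hn : n ≠ 0)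
    (hint : ∀ w, Integrable (ℓ w) μ) (h : jointLaw μ κ = productLaw μ κ) :
    ∫ p, gen μ ℓ p.1 p.2 ∂(jointLaw μ κ) = 0 := by
  by_cases hg : Integrable (fun p : W × (Fin n → Z) => gen μ ℓ p.1 p.2) (jointLaw μ κ)
  · rw [h, productLaw] at hg ⊢
    rw [integral_prod _ hg]
    refine integral_eq_zero_of_ae (ae_of_all _ fun w => ?_)
    have hc : Integrable (centeredLoss μ ℓ w) μ := (hint w).sub (integrable_const _)
    simp_rw [gen_eq_sum_centeredLoss hn, dataLaw]
    rw [integral_div, integral_finsetSum _ fun i _ =>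
      integrable_comp_eval (μ := fun _ : Fin n => μ) hc]
    simp [integral_comp_eval (μ := fun _ : Fin n => μ) hc.aestronglyMeasurable,
      integral_centeredLoss_eq_zero (hint w)]
  -- The Bochner integral of a non-integrable function is 0 by convention.
  · exact integral_undef hg

end Laws

theorem ofReal_abs_le_rpow_half {x : ℝ} {y : ℝ≥0∞} (h : ENNReal.ofReal (x ^ 2) ≤ y) :
    ENNReal.ofReal |x| ≤ y ^ (1 / 2 : ℝ) := by
  rw [one_div, ENNReal.le_rpow_inv_iff two_pos, ENNReal.rpow_ofNat,
    ← ENNReal.ofReal_pow (abs_nonneg x), sq_abs]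
  exact h

end GenBound

theorem corollary1 {W Z : Type*} [MeasurableSpace W] [MeasurableSpace Z]
    (n : ℕ) (hn : 1 ≤ n)
    (μ : Measure Z) [IsProbabilityMeasure μ]
    (κ : Kernel (Fin n → Z) W) [IsMarkovKernel κ]
    (ℓ : W → Z → ℝ) (hℓ_meas : Measurable (Function.uncurry ℓ))
    (hℓ_nonneg : ∀ w z, 0 ≤ ℓ w z)
    (hℓ_int : ∀ w, Integrable (ℓ w) μ) :
    (GenBound.supNormSecondMoment μ ℓ ≠ ∞ →
      Integrable (fun p : W × (Fin n → Z) => GenBound.gen μ ℓ p.1 p.2)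
        (GenBound.jointLaw μ κ)) ∧
    ENNReal.ofReal |∫ p, GenBound.gen μ ℓ p.1 p.2 ∂(GenBound.jointLaw μ κ)| ≤
      (4 * InformationTheory.klDiv (GenBound.jointLaw μ κ) (GenBound.productLaw μ κ) *
        GenBound.supNormSecondMoment μ ℓ / (n : ℝ≥0∞)) ^ (1 / 2 : ℝ) := by
  have hn0 : n ≠ 0 := Nat.one_le_iff_ne_zero.mp hn
  refine ⟨GenBound.integrable_gen hn0 hℓ_meas, GenBound.ofReal_abs_le_rpow_half ?_⟩
  -- If V = 0 or K = 0 the bound is 0, even when the other factor is ∞, so these cases need E[gen] =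
  -- 0 directly. Otherwise an infinite factor makes the bound ∞.
  by_cases hM0 : GenBound.supNormSecondMoment μ ℓ = 0
  · simp [GenBound.integral_gen_eq_zero_of_supNormSecondMoment_eq_zero hn0 hℓ_meas hM0]
  by_cases hK0 : InformationTheory.klDiv (GenBound.jointLaw μ κ) (GenBound.productLaw μ κ) = 0
  · simp [GenBound.integral_gen_eq_zero_of_jointLaw_eq_productLaw hn0 hℓ_int
      (InformationTheory.klDiv_eq_zero_iff.mp hK0)]
  by_cases hM : GenBound.supNormSecondMoment μ ℓ = ∞
  · simp [hM, hK0, ENNReal.mul_top, ENNReal.top_div_of_ne_top]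
  by_cases hK : InformationTheory.klDiv (GenBound.jointLaw μ κ) (GenBound.productLaw μ κ) = ∞
  · simp [hK, hM0, ENNReal.mul_top, ENNReal.top_mul, ENNReal.top_div_of_ne_top]
  calc _ ≤ ENNReal.ofReal _ :=
        ENNReal.ofReal_le_ofReal (GenBound.sq_integral_gen_le hn0 hℓ_meas hℓ_int hM hK)
    _ = _ := by
        rw [ENNReal.ofReal_div_of_pos (by positivity), ENNReal.ofReal_mul (by positivity),
          ENNReal.ofReal_mul (by positivity), ENNReal.ofReal_toReal hK, ENNReal.ofReal_toReal hM]
        simp
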